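/- Let $\mathcal A=\{0,1,\dots,7\}$. Let $\Theta_0,\Theta_1,\Theta_2$ be the antimorphisms of the free monoid $\mathcal A^*$ (maps with $\Theta(vw)=\Theta(w)\Theta(v)$) given on letters by $$\Theta_0:\ 0\mapsto 2,\ 1\mapsto 1,\ 2\mapsto 0,\ 3\mapsto 3,\ 4\mapsto 6,\ 5\mapsto 5,\ 6\mapsto 4,\ 7\mapsto 7,$$ $$\Theta_1:\ 0\mapsto 4,\ 1\mapsto 5,\ 2\mapsto 6,\ 3\mapsto 7,\ 4\mapsto 0,\ 5\mapsto 1,\ 6\mapsto 2,\ 7\mapsto 3,$$ $$\Theta_2:\ 0\mapsto 0,\ 1\mapsto 3,\ 2\mapsto 2,\ 3\mapsto 1,\ 4\mapsto 4,\ 5\mapsto 7,\ 6\mapsto 6,\ 7\mapsto 5,$$ and let $G$ be the group, under composition, generated by $\Theta_0,\Theta_1,\Theta_2$. Let $\varphi$ be the morphism of $\mathcal A^*$ given by $$0\mapsto 01,\quad 1\mapsto 2,\quad 2\mapsto 65,\quad 3\mapsto 4,\quad 4\mapsto 23,\quad 5\mapsto 6,\quad 6\mapsto 47,\quad 7\mapsto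 0 .$$ Definitions. For an infinite word $\mathbf u\in\mathcal A^{\mathbb N}$ let $\mathcal L(\mathbf u)$ be the set of its finite factors. A factor $w$ is special if there are at least two letters $a$ with $aw\in\mathcal L(\mathbf u)$, or at least two letters $a$ with $wa\in\mathcal L(\mathbf u)$. $\mathcal L(\mathbf u)$ is closed under $G$ if $g(w)\in\mathcal L(\mathbf u)$ for all $w\in\mathcal L(\mathbf u)$ and $g\in G$. Write $[w]=\{g(w)\mid g\in G\}$. When $\mathcal L(\mathbf u)$ is closed under $G$, the undirected graph of symmetries $\Gamma_n(\mathbf u)$ is the multigraph (loops and multiple edges allowed) whose vertices are the classes $[w]$ of the special factors $w$ of length $n$, and whose edges are the classes $[e]$ of the factors $e\in\mathcal L(\mathbf u)$ of length at least $n+1$ whose prefix and suffix of length $n$ are special while no other occurrence in $e$ of a factor of length $n$ is special; $[e]$ joins the class of the prefix of length $n$ of $e$ with the class of its suffix of length $n$. The word $\mathbf u$ is $G$-rich if for every $n\ge 1$: $\mathcal L(\mathbf u)$ is closed under $G$; whenever $[e]$ is a loop of $\Gamma_n(\mathbf u)$, there is an antimorphism $\Theta\in G$ with $\Theta(e)=e$;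 and the graph obtained from $\Gamma_n(\mathbf u)$ by removing loops is a tree. Theorem. $G$ is a finite group of morphisms and antimorphisms of $\mathcal A^*$, and $G\cong\mathbb Z_2\times\mathbb Z_2\times\mathbb Z_2$. The morphism $\varphi$ has exactly one fixed point $\mathbf u\in\mathcal A^{\mathbb N}$; its language $\mathcal L(\mathbf u)$ is closed under $G$, and $\mathbf u$ is $G$-rich. -/

import Mathlib

namespace GRich

/-! ### Words, morphisms and antimorphisms

Finite words over `A` are lists, infinite words are maps `ℕ → A`. -/

section Words

variable {A : Type*}

/-- `f` is a morphism of the free monoid of words. -/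
def IsMorphism (f : List A → List A) : Prop := ∀ v w, f (v ++ w) = f v ++ f w

/-- `f` is an antimorphism of the free monoid of words. -/
def IsAntimorphism (f : List A → List A) : Prop := ∀ v w, f (v ++ w) = f w ++ f v

/-- `G` is a finite group consisting of morphisms and antimorphisms (under composition), and it
contains at least one antimorphism. -/
structure IsSymmetryGroup (G : Subgroup (Equiv.Perm (List A))) : Prop where
  finite : Finite G
  morphism_or_antimorphism : ∀ g ∈ G, IsMorphism g ∨ IsAntimorphism g
  exists_antimorphism : ∃ g ∈ G, IsAntimorphism g

/-- The antimorphism of `A*` that extends a permutation `σ` of the letters: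
`w₁ ⋯ wₙ ↦ σ(wₙ) ⋯ σ(w₁)`. -/
def letterAntimorphism (σ : Equiv.Perm A) : Equiv.Perm (List A) where
  toFun w := (w.map σ).reverse
  invFun w := (w.map σ.symm).reverse
  left_inv w := by simp
  right_inv w := by simp

/-- The prefix of length `n` of the infinite word `u`. -/
def prefixWord (u : ℕ → A) (n : ℕ) : List A := (List.range n).map u

/-- For a nonerasing morphism, given by the images `f a` of the letters, `v` is the infinite word
`f(u₀) f(u₁) f(u₂) ⋯`: every word `f(u₀ ⋯ uₙ₋₁)` is a prefix of `v`. -/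
def IsMorphicImage (f : A → List A) (u v : ℕ → A) : Prop :=
  ∀ n, (prefixWord u n).flatMap f = prefixWord v ((prefixWord u n).flatMap f).length

/-- `u` is a fixed point of the nonerasing morphism given by the letter images `f`. -/
def IsFixedPoint (f : A → List A) (u : ℕ → A) : Prop := IsMorphicImage f u u

/-- `i` is an occurrence of the finite word `w` in the infinite word `u`. -/
def IsOccurrence (u : ℕ → A) (w : List A) (i : ℕ) : Prop :=
  w = (List.range w.length).map (fun j => u (i + j))

/-- The language of `u`: the set of all its factors. -/
def language (u : ℕ → A) : Set (List A) := {w | ∃ i, IsOccurrence u w i}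

/-- The set of left extensions of `w` in `u`. -/
def leftExt (u : ℕ → A) (w : List A) : Set A := {a | a :: w ∈ language u}

/-- The set of right extensions of `w` in `u`. -/
def rightExt (u : ℕ → A) (w : List A) : Set A := {a | w ++ [a] ∈ language u}

/-- `w` is a factor of `u` that is left special or right special (it has at least two left
extensions or at least two right extensions). -/
def IsSpecial (u : ℕ → A) (w : List A) : Prop :=
  w ∈ language u ∧ ((leftExt u w).Nontrivial ∨ (rightExt u w).Nontrivial)

/-- The language of `u` is closed under `G`. -/
def IsClosedUnder (G : Subgroup (Equiv.Perm (List A))) (u : ℕ → A) : Prop :=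
  ∀ g ∈ G, ∀ w ∈ language u, g w ∈ language u

/-- `w` is a `G`-palindrome: it is fixed by some antimorphism belonging to `G`. -/
def IsGPalindrome (G : Subgroup (Equiv.Perm (List A))) (w : List A) : Prop :=
  ∃ g ∈ G, IsAntimorphism g ∧ g w = w

/-- The class `[w] = {g(w) | g ∈ G}`. -/
def wordClass (G : Subgroup (Equiv.Perm (List A))) (w : List A) : Set (List A) :=
  {v | ∃ g ∈ G, v = g w}

/-- The suffix of length `n` of `w` (for `n ≤ |w|`). -/
def suffixWord (w : List A) (n : ℕ) : List A := w.drop (w.length - n)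

/-! ### Elementary facts -/

theorem mem_wordClass_self (G : Subgroup (Equiv.Perm (List A))) (w : List A) :
    w ∈ wordClass G w := ⟨1, G.one_mem, rfl⟩

theorem wordClass_apply {G : Subgroup (Equiv.Perm (List A))} {g : Equiv.Perm (List A)}
    (hg : g ∈ G) (w : List A) : wordClass G (g w) = wordClass G w := by
  ext v
  constructor
  · rintro ⟨h, hh, rfl⟩
    exact ⟨h * g, G.mul_mem hh hg, rfl⟩
  · rintro ⟨h, hh, rfl⟩
    exact ⟨h * g⁻¹, G.mul_mem hh (G.inv_mem hg), by simp⟩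

theorem le_length_of_isMorphism_or_isAntimorphism (g : Equiv.Perm (List A))
    (h : IsMorphism g ∨ IsAntimorphism g) (w : List A) : w.length ≤ (g w).length := by
  have h0 : g [] = [] := by
    rcases h with h | h
    · simpa using h [] []
    · simpa using h [] []
  induction w with
  | nil => simp
  | cons a w ih =>
    have ha : 1 ≤ (g [a]).length := by
      rcases Nat.eq_zero_or_pos (g [a]).length with hz | hz
      · have h1 : g [a] = g [] := by rw [h0]; exact List.length_eq_zero_iff.mp hz
        simpa using g.injective h1
      · exact hz
    have hs : (g (a :: w)).length = (g [a]).length + (g w).length := by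
      rcases h with h | h
      · simpa using congrArg List.length (h [a] w)
      · simpa [add_comm] using congrArg List.length (h [a] w)
    simp only [List.length_cons]
    omega

theorem length_apply {G : Subgroup (Equiv.Perm (List A))} (hG : IsSymmetryGroup G)
    {g : Equiv.Perm (List A)} (hg : g ∈ G) (w : List A) : (g w).length = w.length := by
  refine le_antisymm ?_
    (le_length_of_isMorphism_or_isAntimorphism g (hG.morphism_or_antimorphism g hg) w)
  have := le_length_of_isMorphism_or_isAntimorphism g⁻¹
    (hG.morphism_or_antimorphism _ (G.inv_mem hg)) (g w)
  simpa using this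

/-- An element of `G` either keeps the classes of the two ends of a word, or exchanges them. -/
theorem ends_apply {G : Subgroup (Equiv.Perm (List A))} (hG : IsSymmetryGroup G)
    {g : Equiv.Perm (List A)} (hg : g ∈ G) {e : List A} {n : ℕ} (hn : n ≤ e.length) :
    (wordClass G ((g e).take n) = wordClass G (e.take n) ∧
      wordClass G (suffixWord (g e) n) = wordClass G (suffixWord e n)) ∨
    (wordClass G ((g e).take n) = wordClass G (suffixWord e n) ∧
      wordClass G (suffixWord (g e) n) = wordClass G (e.take n)) := by
  have hl := length_apply hG hg
  have e1 := List.take_append_drop n e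
  have e2 := List.take_append_drop (e.length - n) e
  rcases hG.morphism_or_antimorphism g hg with h | h
  · left
    have h1 : (g e).take n = g (e.take n) := by
      conv_lhs => rw [← e1, h]
      exact List.take_left' (by simp [hl, hn])
    have h2 : suffixWord (g e) n = g (suffixWord e n) := by
      unfold suffixWord
      rw [hl]
      conv_lhs => rw [← e2, h, e2]
      exact List.drop_left' (by simp [hl])
    rw [h1, h2, wordClass_apply hg, wordClass_apply hg]
    exact ⟨rfl, rfl⟩
  · right
    have h1 : (g e).take n = g (suffixWord e n) := by
      unfold suffixWord
      conv_lhs => rw [← e2, h]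
      exact List.take_left' (by simp [hl]; omega)
    have h2 : suffixWord (g e) n = g (e.take n) := by
      unfold suffixWord
      rw [hl]
      conv_lhs => rw [← e1, h, e1]
      exact List.drop_left' (by simp [hl])
    rw [h1, h2, wordClass_apply hg, wordClass_apply hg]
    exact ⟨rfl, rfl⟩

/-! ### Graphs of symmetries and richness -/

/-- `e` is an edge of the directed graph of symmetries of order `n`, from the class of its prefix
of length `n` to the class of its suffix of length `n`: a factor of `u` of length at least `n + 1`
whose prefix and suffix of length `n` are special, and which has no other occurrence of a special
factor of length `n`. -/
structure IsEdgeWord (u : ℕ → A) (n : ℕ) (e : List A) : Prop where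
  mem_language : e ∈ language u
  lt_length : n < e.length
  special_prefix : IsSpecial u (e.take n)
  special_suffix : IsSpecial u (suffixWord e n)
  not_special : ∀ i, 0 < i → i < e.length - n → ¬ IsSpecial u ((e.drop i).take n)

/-- The undirected graph of symmetries of `u` of order `n`, a multigraph with loops. Its vertices
are the classes `[w]` of the special factors `w` of length `n`, its edges are the classes `[e]` of
the edges `e` of the directed graph of symmetries, and `[e]` joins the class of the prefix of length
`n` of `e` with the class of the suffix of length `n` of `e`. -/
def symmetryGraph (G : Subgroup (Equiv.Perm (List A))) (hG : IsSymmetryGroup G) (u : ℕ → A)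
    (n : ℕ) : Graph (Set (List A)) (Set (List A)) where
  vertexSet := {x | ∃ w, w.length = n ∧ IsSpecial u w ∧ x = wordClass G w}
  IsLink E x y := ∃ e, IsEdgeWord u n e ∧ E = wordClass G e ∧
    ((x = wordClass G (e.take n) ∧ y = wordClass G (suffixWord e n)) ∨
      (x = wordClass G (suffixWord e n) ∧ y = wordClass G (e.take n)))
  isLink_symm := by
    intro E _
    refine ⟨?_⟩
    rintro x y ⟨e, he, hE, h | h⟩
    · exact ⟨e, he, hE, Or.inr ⟨h.2, h.1⟩⟩
    · exact ⟨e, he, hE, Or.inl ⟨h.2, h.1⟩⟩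
  eq_or_eq_of_isLink_of_isLink := by
    rintro E x y v w ⟨e, he, hE, h⟩ ⟨e', he', hE', h'⟩
    obtain ⟨g, hg, rfl⟩ : e' ∈ wordClass G e := hE ▸ hE' ▸ mem_wordClass_self G e'
    have key := ends_apply hG hg he.lt_length.le
    grind
  left_mem_of_isLink := by
    rintro E x y ⟨e, he, hE, h | h⟩
    · exact ⟨_, by simp [he.lt_length.le], he.special_prefix, h.1⟩
    · exact ⟨_, by have := he.lt_length; simp [suffixWord]; omega, he.special_suffix, h.1⟩

/-- A multigraph is a tree if it has neither loops nor multiple edges and is a tree as a simple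
graph (connected and acyclic). -/
def IsMultigraphTree {V E : Type*} (Γ : Graph V E) : Prop := Γ.Simple ∧ Γ.toSimpleGraph.IsTree

/-- The multigraph obtained by removing all loops. -/
def removeLoops {V E : Type*} (Γ : Graph V E) : Graph V E := Γ.deleteEdges {e | ∃ x, Γ.IsLoopAt e x}

/-- Property `G`-tls(`N`): for every `n ≥ N`, the language is closed under `G`, every loop `[e]` of
the undirected graph of symmetries of order `n` comes from a `G`-palindrome `e`, and this graph
becomes a tree when its loops are removed. -/
def PropertyTls (G : Subgroup (Equiv.Perm (List A))) (hG : IsSymmetryGroup G) (u : ℕ → A)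
    (N : ℕ) : Prop :=
  ∀ n, N ≤ n → IsClosedUnder G u ∧
    (∀ e x, (symmetryGraph G hG u n).IsLoopAt (wordClass G e) x → IsGPalindrome G e) ∧
    IsMultigraphTree (removeLoops (symmetryGraph G hG u n))

/-- `u` is `G`-rich. -/
def IsRich (G : Subgroup (Equiv.Perm (List A))) (hG : IsSymmetryGroup G) (u : ℕ → A) : Prop :=
  PropertyTls G hG u 1

end Words

/-! ### The group and the morphism on the eight-letter alphabet -/

/-- `0 ↦ 2, 1 ↦ 1, 2 ↦ 0, 3 ↦ 3, 4 ↦ 6, 5 ↦ 5, 6 ↦ 4, 7 ↦ 7` -/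
def sigma0 : Equiv.Perm (Fin 8) where
  toFun := ![2, 1, 0, 3, 6, 5, 4, 7]
  invFun := ![2, 1, 0, 3, 6, 5, 4, 7]
  left_inv := by intro a; fin_cases a <;> rfl
  right_inv := by intro a; fin_cases a <;> rfl

/-- `0 ↦ 4, 1 ↦ 5, 2 ↦ 6, 3 ↦ 7, 4 ↦ 0, 5 ↦ 1, 6 ↦ 2, 7 ↦ 3` -/
def sigma1 : Equiv.Perm (Fin 8) where
  toFun := ![4, 5, 6, 7, 0, 1, 2, 3]
  invFun := ![4, 5, 6, 7, 0, 1, 2, 3]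
  left_inv := by intro a; fin_cases a <;> rfl
  right_inv := by intro a; fin_cases a <;> rfl

/-- `0 ↦ 0, 1 ↦ 3, 2 ↦ 2, 3 ↦ 1, 4 ↦ 4, 5 ↦ 7, 6 ↦ 6, 7 ↦ 5` -/
def sigma2 : Equiv.Perm (Fin 8) where
  toFun := ![0, 3, 2, 1, 4, 7, 6, 5]
  invFun := ![0, 3, 2, 1, 4, 7, 6, 5]
  left_inv := by intro a; fin_cases a <;> rfl
  right_inv := by intro a; fin_cases a <;> rfl

/-- The group generated by the three antimorphisms `Θ₀`, `Θ₁`, `Θ₂`. -/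
def groupG : Subgroup (Equiv.Perm (List (Fin 8))) :=
  Subgroup.closure
    {letterAntimorphism sigma0, letterAntimorphism sigma1, letterAntimorphism sigma2}

/-- The letter images of the morphism
`0 ↦ 01, 1 ↦ 2, 2 ↦ 65, 3 ↦ 4, 4 ↦ 23, 5 ↦ 6, 6 ↦ 47, 7 ↦ 0`. -/
def phi : Fin 8 → List (Fin 8) :=
  ![[0, 1], [2], [6, 5], [4], [2, 3], [6], [4, 7], [0]]

end GRich

/-!
The letters of the alphabet are projected to their parities. The morphism `phi` then becomes the
Fibonacci morphism `a ↦ ab`, `b ↦ a`, and its fixed point `u` projects to the Fibonacci word `f`.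
Only twelve pairs of letters are factors of `u`, and in such a pair each letter is determined by the
other one and its own parity (`IsPair.right_inj`, `IsPair.left_inj`). So a factor of `u` is
determined by its first letter and its projection (`eq_of_isChain`). The four morphisms in the group
`G` preserve parities, act transitively on the letters of each parity, and preserve the language
since `phi` intertwines them; hence a nonempty word is a factor of `u` as soon as its pairs of
letters are admissible and its projection is a factor of `f`
(`IsFixedPoint.mem_language_iff_parity`). The antimorphisms in `G` project to reversal. In this way
all claims about `u` and `G` reduce to claims about `f` and reversal.

For the Fibonacci word, desubstitution shows that the left special factors are the prefixes
(`IsFixedPoint.leftExt_nontrivial_iff`), and the language is closed under reversal, so the right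
special factors are the reversals of the prefixes. Therefore the special factors of length `n` of
`u` form a single class, and the graph of symmetries of order `n` has one vertex: without loops it
is a tree. It remains to see that edges are `G`-palindromes, which holds as all edges for the
Fibonacci word are palindromes (`EdgeAt.reverse_eq`): an edge that is not a palindrome would force
the occurrences of some prefix of `f` to be the multiples of a number `D > 1`, whereas the blocks
`φᵐ(a)` and `φᵐ(b)` of `f` have coprime lengths (`IsFixedPoint.eq_one_of_dvd_occurrences`).
-/

namespace GRich

/-! ### Factors of infinite words -/

section Factors

variable {A : Type*} {u v : ℕ → A}

/-- The factor of length `n` of `u` that starts at position `i`. -/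
def factor (u : ℕ → A) (i n : ℕ) : List A := (List.range n).map fun j => u (i + j)

@[simp] theorem length_factor (u : ℕ → A) (i n : ℕ) : (factor u i n).length = n := by
  simp [factor]

theorem prefixWord_eq_factor (u : ℕ → A) (n : ℕ) : prefixWord u n = factor u 0 n := by
  simp [prefixWord, factor]

theorem isOccurrence_iff {w : List A} {i : ℕ} :
    IsOccurrence u w i ↔ w = factor u i w.length := Iff.rfl

@[simp] theorem factor_zero (u : ℕ → A) (i : ℕ) : factor u i 0 = [] := rfl

theorem factor_one (u : ℕ → A) (i : ℕ) : factor u i 1 = [u i] := rfl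

theorem factor_add (u : ℕ → A) (i m n : ℕ) :
    factor u i (m + n) = factor u i m ++ factor u (i + m) n := by
  simp [factor, List.range_add, Function.comp_def, add_assoc]

theorem factor_succ (u : ℕ → A) (i n : ℕ) : factor u i (n + 1) = factor u i n ++ [u (i + n)] :=
  factor_add u i n 1

theorem factor_succ' (u : ℕ → A) (i n : ℕ) : factor u i (n + 1) = u i :: factor u (i + 1) n := by
  rw [add_comm, factor_add]; rfl

theorem map_factor {B : Type*} (g : A → B) (u : ℕ → A) (i n : ℕ) :
    (factor u i n).map g = factor (fun k => g (u k)) i n := by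
  simp [factor]

theorem take_factor (u : ℕ → A) (i : ℕ) {k n : ℕ} (h : k ≤ n) :
    (factor u i n).take k = factor u i k := by
  obtain ⟨m, rfl⟩ := Nat.exists_eq_add_of_le h
  rw [factor_add]
  exact List.take_left' (by simp)

theorem drop_factor (u : ℕ → A) (i k m : ℕ) :
    (factor u i (k + m)).drop k = factor u (i + k) m := by
  rw [factor_add]
  exact List.drop_left' (by simp)

theorem factor_mem_language (u : ℕ → A) (i n : ℕ) : factor u i n ∈ language u :=
  ⟨i, by rw [isOccurrence_iff, length_factor]⟩

theorem IsOccurrence.append_iff {w x : List A} {i : ℕ} :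
    IsOccurrence u (w ++ x) i ↔ IsOccurrence u w i ∧ IsOccurrence u x (i + w.length) := by
  simp only [isOccurrence_iff, List.length_append, factor_add]
  exact ⟨fun h => List.append_inj h (by simp), fun h => congrArg₂ _ h.1 h.2⟩

theorem mem_language_of_infix {w x : List A} (h : w <:+: x) (hx : x ∈ language u) :
    w ∈ language u := by
  obtain ⟨s, t, rfl⟩ := h
  obtain ⟨i, hi⟩ := hx
  exact ⟨_, (IsOccurrence.append_iff.1 (IsOccurrence.append_iff.1 hi).1).2⟩

theorem IsOccurrence.of_prefix {w x : List A} {i : ℕ} (hx : IsOccurrence u x i) (h : w <+: x) :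
    IsOccurrence u w i := by
  obtain ⟨t, rfl⟩ := h
  exact (IsOccurrence.append_iff.1 hx).1

theorem isOccurrence_factor (u : ℕ → A) (i n : ℕ) : IsOccurrence u (factor u i n) i := by
  rw [isOccurrence_iff, length_factor]

/-- Two words that occur at the same position are comparable. -/
theorem IsOccurrence.prefix_of_length_le {w x : List A} {i : ℕ} (hw : IsOccurrence u w i)
    (hx : IsOccurrence u x i) (h : w.length ≤ x.length) : w <+: x := by
  rw [isOccurrence_iff] at hw hx
  rw [hw, hx, ← take_factor u i h]
  exact List.take_prefix _ _

theorem mem_language_iff_prefix {w : List A} :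
    w ∈ language u ↔ ∃ p, IsOccurrence u (p ++ w) 0 := by
  constructor
  · rintro ⟨i, hi⟩
    exact ⟨factor u 0 i, IsOccurrence.append_iff.2 ⟨isOccurrence_factor u 0 i, by simpa using hi⟩⟩
  · rintro ⟨p, hp⟩
    exact ⟨_, (IsOccurrence.append_iff.1 hp).2⟩

end Factors

/-! ### Fixed points of morphisms -/

section FixedPoints

variable {A : Type*} {u v : ℕ → A} {f : A → List A}

theorem length_le_length_flatMap (hf : ∀ a, f a ≠ []) (w : List A) :
    w.length ≤ (w.flatMap f).length := by
  induction w with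
  | nil => simp
  | cons a w ih =>
    have := List.length_pos_iff.2 (hf a)
    simp only [List.flatMap_cons, List.length_append, List.length_cons]
    omega

theorem IsFixedPoint.isOccurrence_flatMap (h : IsFixedPoint f u) {w : List A}
    (hw : IsOccurrence u w 0) : IsOccurrence u (w.flatMap f) 0 := by
  have := h w.length
  rw [prefixWord_eq_factor, ← isOccurrence_iff.1 hw, prefixWord_eq_factor] at this
  exact this

theorem IsFixedPoint.isOccurrence_iterate (h : IsFixedPoint f u) {w : List A}
    (hw : IsOccurrence u w 0) (k : ℕ) : IsOccurrence u ((List.flatMap f)^[k] w) 0 := by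
  induction k with
  | zero => exact hw
  | succ k ih => rw [Function.iterate_succ_apply']; exact h.isOccurrence_flatMap ih

theorem iterate_flatMap_append (f : A → List A) (k : ℕ) (v w : List A) :
    (List.flatMap f)^[k] (v ++ w) = (List.flatMap f)^[k] v ++ (List.flatMap f)^[k] w := by
  induction k generalizing v w with
  | zero => rfl
  | succ k ih => simp [Function.iterate_succ_apply, ih]

theorem IsFixedPoint.iterate_mem_language (h : IsFixedPoint f u) {w : List A}
    (hw : w ∈ language u) (k : ℕ) : (List.flatMap f)^[k] w ∈ language u := by
  obtain ⟨p, hp⟩ := mem_language_iff_prefix.1 hw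
  have := h.isOccurrence_iterate hp k
  rw [iterate_flatMap_append] at this
  exact mem_language_iff_prefix.2 ⟨_, this⟩

theorem IsFixedPoint.flatMap_mem_language (h : IsFixedPoint f u) {w : List A}
    (hw : w ∈ language u) : w.flatMap f ∈ language u := h.iterate_mem_language hw 1

theorem isOccurrence_singleton (u : ℕ → A) (i : ℕ) : IsOccurrence u [u i] i := by
  simp [isOccurrence_iff, factor_one]

/-- The letter images of a fixed point begin with its first letter. -/
theorem IsFixedPoint.head?_eq (h : IsFixedPoint f u) (hf : f (u 0) ≠ []) :
    (f (u 0)).head? = some (u 0) := by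
  have h1 := h.isOccurrence_flatMap (isOccurrence_singleton u 0)
  simp only [List.flatMap_singleton] at h1
  obtain ⟨b, t, hbt⟩ := List.exists_cons_of_ne_nil hf
  rw [hbt, isOccurrence_iff, List.length_cons, factor_succ'] at h1
  rw [hbt, (List.cons_eq_cons.1 h1).1]
  rfl

theorem lt_length_iterate (hf : ∀ a, f a ≠ []) {a : A} {t : List A} (ha : f a = a :: t)
    (ht : t ≠ []) (k : ℕ) :
    [a] <+: (List.flatMap f)^[k] [a] ∧ k < ((List.flatMap f)^[k] [a]).length := by
  induction k with
  | zero => simp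
  | succ k ih =>
    obtain ⟨⟨s, hs⟩, hk⟩ := ih
    rw [Function.iterate_succ_apply', ← hs]
    have h1 := length_le_length_flatMap hf s
    have h2 := List.length_pos_iff.2 ht
    have h3 := congrArg List.length hs
    simp only [List.length_append, List.length_singleton] at h3
    constructor
    · simp [ha]
    · simp only [List.flatMap_append, List.flatMap_singleton, ha, List.length_append,
        List.length_cons]
      omega

theorem IsFixedPoint.lt_length_iterate (h : IsFixedPoint f u) (hf : ∀ a, f a ≠ [])
    (h2 : 2 ≤ (f (u 0)).length) (k : ℕ) : k < ((List.flatMap f)^[k] [u 0]).length := by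
  have h1 := h.head?_eq (hf _)
  obtain ⟨b, t, hbt⟩ := List.exists_cons_of_ne_nil (hf (u 0))
  have hb : b = u 0 := by simpa [hbt] using h1
  subst hb
  refine (GRich.lt_length_iterate hf hbt ?_ k).2
  rintro rfl
  simp [hbt] at h2

/-- Every factor of a fixed point occurs in an iterate of the morphism on the first letter. -/
theorem IsFixedPoint.exists_infix_iterate (h : IsFixedPoint f u) (hf : ∀ a, f a ≠ [])
    (h2 : 2 ≤ (f (u 0)).length) {w : List A} (hw : w ∈ language u) :
    ∃ k, w <:+: (List.flatMap f)^[k] [u 0] := by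
  obtain ⟨p, hp⟩ := mem_language_iff_prefix.1 hw
  refine ⟨(p ++ w).length, List.IsInfix.trans ?_ (hp.prefix_of_length_le
    (h.isOccurrence_iterate (isOccurrence_singleton u 0) _)
    (h.lt_length_iterate hf h2 _).le).isInfix⟩
  exact (List.suffix_append p w).isInfix

theorem IsFixedPoint.eq_of_apply_zero_eq (hu : IsFixedPoint f u) (hv : IsFixedPoint f v)
    (hf : ∀ a, f a ≠ []) (h2 : 2 ≤ (f (u 0)).length) (h0 : u 0 = v 0) : u = v := by
  have key : ∀ n, factor u 0 (n + 1) = factor v 0 (n + 1) := by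
    intro n
    have h3 := hu.isOccurrence_iterate (isOccurrence_singleton u 0) n
    have h4 := hv.isOccurrence_iterate (isOccurrence_singleton v 0) n
    have h5 := hu.lt_length_iterate hf h2 n
    rw [← h0, isOccurrence_iff] at h4
    rw [isOccurrence_iff] at h3
    rw [← take_factor u 0 (Nat.succ_le_of_lt h5), ← h3,
      ← take_factor v 0 (Nat.succ_le_of_lt h5), ← h4]
  funext n
  have := key n
  rw [factor_succ, factor_succ] at this
  simpa using (List.append_inj' this rfl).2

/-- A nonerasing morphism with `a ↦ a t`, `t ≠ ε`, has a fixed point: the limit of the images of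
`a` under its powers. -/
theorem exists_isFixedPoint (hf : ∀ a, f a ≠ []) {a : A} {t : List A} (ha : f a = a :: t)
    (ht : t ≠ []) : ∃ u, IsFixedPoint f u := by
  let W : ℕ → List A := fun k => (List.flatMap f)^[k] [a]
  have hW : ∀ k, W (k + 1) = (W k).flatMap f := fun k => Function.iterate_succ_apply' _ _ _
  have hlen : ∀ k, k < (W k).length := fun k => (lt_length_iterate hf ha ht k).2
  have hstep : ∀ k, W k <+: W (k + 1) := by
    intro k
    induction k with
    | zero => simp [W, ha]
    | succ k ih =>
      rw [hW k, hW (k + 1)]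
      exact ih.flatMap f
  have hmono : ∀ k m, k ≤ m → W k <+: W m := fun k m hkm => by
    induction m, hkm using Nat.le_induction with
    | base => exact List.prefix_rfl
    | succ m _ ih => exact ih.trans (hstep m)
  let u : ℕ → A := fun n => (W n)[n]'(hlen n)
  have hocc : ∀ k, IsOccurrence u (W k) 0 := by
    intro k
    rw [isOccurrence_iff]
    refine List.ext_getElem (by simp) fun j h1 h2 => ?_
    simp only [factor, zero_add, List.getElem_map, List.getElem_range, u]
    rcases le_total k j with h | h
    · exact (hmono k j h).getElem h1
    · exact ((hmono j k h).getElem (hlen j)).symm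
  refine ⟨u, fun n => ?_⟩
  rw [prefixWord_eq_factor, prefixWord_eq_factor]
  refine IsOccurrence.of_prefix (hocc (n + 1)) ?_
  rw [hW]
  refine List.IsPrefix.flatMap ?_ f
  exact (isOccurrence_factor u 0 n).prefix_of_length_le (hocc n) (by simpa using (hlen n).le)

end FixedPoints

/-! ### The Fibonacci word -/

section Fibonacci

/-- The letter images of the Fibonacci morphism `a ↦ ab`, `b ↦ a`, with `a = false`, `b = true`. -/
def fibMorphism : Bool → List Bool
  | false => [false, true]
  | true => [false]

@[simp] theorem fibMorphism_false : fibMorphism false = [false, true] := rfl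

@[simp] theorem fibMorphism_true : fibMorphism true = [false] := rfl

theorem fibMorphism_ne_nil : ∀ x, fibMorphism x ≠ [] := by decide

/-- Desubstitution of a word that begins at a block boundary: `ab` is read as the block of `a`, and
an `a` followed by `a` as the block of `b`. A final `a`, which may belong to either block, is
dropped. -/
def decode : List Bool → List Bool
  | false :: true :: w => false :: decode w
  | false :: false :: w => true :: decode (false :: w)
  | _ => []

theorem length_decode_le (w : List Bool) : (decode w).length ≤ w.length - 1 := by
  fun_induction decode w with
  | case1 w ih => simp; omega
  | case2 w ih => simp at ih ⊢; omega
  | case3 w => simp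

theorem decode_prefix {w v : List Bool} (h : w <+: v.flatMap fibMorphism) :
    decode w <+: v ∧ w <+: (decode w).flatMap fibMorphism ++ [false] := by
  fun_induction decode w generalizing v with
  | case1 w ih =>
    match v with
    | [] => simp at h
    | false :: v =>
      simp only [List.flatMap_cons, fibMorphism_false, List.cons_append, List.nil_append,
        List.cons_prefix_cons, true_and] at h ⊢
      exact ih h
    | [true] => simp at h
    | true :: false :: v => simp at h
    | true :: true :: v => simp at h
  | case2 w ih =>
    match v with
    | [] => simp at h
    | false :: v => simp at h
    | true :: v =>
      simp only [List.flatMap_cons, fibMorphism_true, List.cons_append, List.nil_append,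
        List.cons_prefix_cons, true_and] at h ⊢
      exact ih h
  | case3 w h1 h2 =>
    match w, v with
    | [], _ => simp
    | [false], _ => simp
    | true :: w, [] => simp at h
    | true :: w, false :: v => simp at h
    | true :: w, true :: v => simp at h
    | false :: true :: w, _ => exact absurd rfl (h1 w)
    | false :: false :: w, _ => exact absurd rfl (h2 w)

/-- A block ending with the letter `x`, followed by the beginning of another block, is the image of
the letter different from `x`. Hence a factor that starts with the last letter `x` of a block is
desubstituted to a factor that starts with the letter different from `x`. -/
theorem cons_decode_infix {x : Bool} {w v : List Bool}
    (h : x :: false :: w <:+: v.flatMap fibMorphism) :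
    (!x) :: decode (false :: w) <:+: v ∧
      false :: w <+: (decode (false :: w)).flatMap fibMorphism ++ [false] := by
  induction v with
  | nil => simp at h
  | cons c v ih =>
    have tail (h : x :: false :: w <:+: v.flatMap fibMorphism) :
        (!x) :: decode (false :: w) <:+: c :: v ∧
          false :: w <+: (decode (false :: w)).flatMap fibMorphism ++ [false] :=
      ⟨(ih h).1.trans (List.suffix_cons c v).isInfix, (ih h).2⟩
    cases c with
    | true =>
      simp only [List.flatMap_cons, fibMorphism_true, List.cons_append, List.nil_append,
        List.infix_cons_iff, List.cons_prefix_cons] at h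
      rcases h with ⟨rfl, h⟩ | h
      · exact ⟨(List.cons_prefix_cons.2 ⟨rfl, (decode_prefix h).1⟩).isInfix, (decode_prefix h).2⟩
      · exact tail h
    | false =>
      simp only [List.flatMap_cons, fibMorphism_false, List.cons_append, List.nil_append,
        List.infix_cons_iff, List.cons_prefix_cons] at h
      rcases h with ⟨rfl, h, _⟩ | ⟨rfl, h⟩ | h
      · simp at h
      · exact ⟨(List.cons_prefix_cons.2 ⟨rfl, (decode_prefix h).1⟩).isInfix, (decode_prefix h).2⟩
      · exact tail h

theorem not_true_true_infix (w v : List Bool) :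
    ¬ true :: true :: w <:+: v.flatMap fibMorphism := by
  induction v with
  | nil => simp
  | cons c v ih =>
    cases c with
    | true => simpa [List.infix_cons_iff] using ih
    | false =>
      cases v with
      | nil => simp [List.infix_cons_iff]
      | cons d v => cases d <;> simpa [List.infix_cons_iff] using ih

variable {f : ℕ → Bool}

theorem IsFixedPoint.fib_zero (h : IsFixedPoint fibMorphism f) : f 0 = false := by
  have := h.head?_eq (fibMorphism_ne_nil _)
  cases h0 : f 0 <;> simp [h0] at this ⊢

theorem IsFixedPoint.fib_iterate (h : IsFixedPoint fibMorphism f) (k : ℕ) :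
    IsOccurrence f ((List.flatMap fibMorphism)^[k] [false]) 0 := by
  have := h.isOccurrence_iterate (isOccurrence_singleton f 0) k
  rwa [h.fib_zero] at this

theorem IsFixedPoint.fib_two_le (h : IsFixedPoint fibMorphism f) :
    2 ≤ (fibMorphism (f 0)).length := by
  simp [h.fib_zero]

theorem IsFixedPoint.exists_infix_flatMap (h : IsFixedPoint fibMorphism f) {w : List Bool}
    (hw : w ∈ language f) : ∃ v ∈ language f, w <:+: v.flatMap fibMorphism := by
  obtain ⟨k, hk⟩ := h.exists_infix_iterate fibMorphism_ne_nil h.fib_two_le hw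
  have h1 := h.isOccurrence_iterate (isOccurrence_singleton f 0)
  refine ⟨_, ⟨0, h1 k⟩, hk.trans ?_⟩
  rw [← Function.iterate_succ_apply' (List.flatMap fibMorphism)]
  refine ((h1 k).prefix_of_length_le (h1 (k + 1)) ?_).isInfix
  rw [Function.iterate_succ_apply']
  exact length_le_length_flatMap fibMorphism_ne_nil _

/-- The image of a factor is always followed by the letter `a`. -/
theorem IsFixedPoint.fib_append_mem_language (h : IsFixedPoint fibMorphism f) {w : List Bool}
    (hw : w ∈ language f) : w.flatMap fibMorphism ++ [false] ∈ language f := by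
  obtain ⟨i, hi⟩ := hw
  have h1 : w ++ [f (i + w.length)] ∈ language f :=
    ⟨i, IsOccurrence.append_iff.2 ⟨hi, isOccurrence_singleton f _⟩⟩
  have h2 := h.flatMap_mem_language h1
  refine mem_language_of_infix (List.IsPrefix.isInfix ?_) h2
  cases f (i + w.length) <;> simp

theorem IsFixedPoint.fib_append_isOccurrence (h : IsFixedPoint fibMorphism f) {w : List Bool}
    (hw : IsOccurrence f w 0) : IsOccurrence f (w.flatMap fibMorphism ++ [false]) 0 := by
  have h1 : IsOccurrence f (w ++ [f (0 + w.length)]) 0 :=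
    IsOccurrence.append_iff.2 ⟨hw, isOccurrence_singleton f _⟩
  refine (h.isOccurrence_flatMap h1).of_prefix ?_
  cases f (0 + w.length) <;> simp

/-- Left special factors are prefixes: desubstitution turns a left special factor into a shorter
one. -/
theorem IsFixedPoint.isOccurrence_zero_of_leftSpecial (h : IsFixedPoint fibMorphism f)
    (w : List Bool) (hw : ∀ x, x :: w ∈ language f) : IsOccurrence f w 0 := by
  match w with
  | [] => exact isOccurrence_factor f 0 0
  | true :: w =>
    obtain ⟨v, _, hv⟩ := h.exists_infix_flatMap (hw true)
    exact absurd hv (not_true_true_infix w v)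
  | false :: w =>
    have hd : ∀ x, x :: decode (false :: w) ∈ language f := fun x => by
      obtain ⟨v, hv, hvw⟩ := h.exists_infix_flatMap (hw !x)
      simpa using mem_language_of_infix (cons_decode_infix hvw).1 hv
    have hlen : (decode (false :: w)).length < (false :: w).length := by
      have := length_decode_le (false :: w)
      simp only [List.length_cons] at this ⊢
      omega
    have ih := h.isOccurrence_zero_of_leftSpecial _ hd
    obtain ⟨v, _, hvw⟩ := h.exists_infix_flatMap (hw true)
    exact (h.fib_append_isOccurrence ih).of_prefix (cons_decode_infix hvw).2
termination_by w.length
decreasing_by exact hlen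

/-- Prefixes are left special: if the prefix `p` is, then so is the longer prefix `φ(p)a`. -/
theorem IsFixedPoint.cons_mem_language_of_isOccurrence_zero (h : IsFixedPoint fibMorphism f)
    {w : List Bool} (hw : IsOccurrence f w 0) (x : Bool) : x :: w ∈ language f := by
  have key : ∀ k, ∃ p, k ≤ p.length ∧ IsOccurrence f p 0 ∧ ∀ x, x :: p ∈ language f := by
    intro k
    induction k with
    | zero =>
      have h2 : [false, true] ∈ language f := ⟨0, h.fib_iterate 1⟩
      refine ⟨[], le_rfl, isOccurrence_factor f 0 0, fun x => mem_language_of_infix ?_ h2⟩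
      cases x <;> simp [List.infix_cons_iff]
    | succ k ih =>
      obtain ⟨p, hk, hp, hx⟩ := ih
      refine ⟨p.flatMap fibMorphism ++ [false], ?_, h.fib_append_isOccurrence hp, fun x => ?_⟩
      · have := length_le_length_flatMap fibMorphism_ne_nil p
        simp only [List.length_append, List.length_singleton]
        omega
      · refine mem_language_of_infix (List.IsSuffix.isInfix ?_) (h.fib_append_mem_language (hx !x))
        cases x
        · simp
        · simp
  obtain ⟨p, hk, hp, hx⟩ := key w.length
  refine mem_language_of_infix (List.IsPrefix.isInfix ?_) (hx x)
  exact List.cons_prefix_cons.2 ⟨rfl, hw.prefix_of_length_le hp hk⟩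

theorem reverse_flatMap_fibMorphism (w : List Bool) :
    (w.flatMap fibMorphism ++ [false]).reverse = w.reverse.flatMap fibMorphism ++ [false] := by
  induction w with
  | nil => rfl
  | cons x w ih =>
    rw [List.flatMap_cons, List.append_assoc, List.reverse_append, ih]
    cases x <;> simp

theorem IsFixedPoint.reverse_mem_language (h : IsFixedPoint fibMorphism f) {w : List Bool}
    (hw : w ∈ language f) : w.reverse ∈ language f := by
  have key : ∀ k, ((List.flatMap fibMorphism)^[k] [f 0]).reverse ∈ language f := by
    intro k
    induction k with
    | zero => exact ⟨0, isOccurrence_singleton f 0⟩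
    | succ k ih =>
      rw [Function.iterate_succ_apply']
      refine mem_language_of_infix (List.IsSuffix.isInfix ?_) (h.fib_append_mem_language ih)
      rw [← reverse_flatMap_fibMorphism]
      simp
  obtain ⟨k, hk⟩ := h.exists_infix_iterate fibMorphism_ne_nil h.fib_two_le hw
  exact mem_language_of_infix (List.reverse_infix.2 hk) (key k)

/-- The occurrences of a prefix of the Fibonacci word have no common divisor: the word is a
concatenation of the blocks `φᵐ(a)` and `φᵐ(b)`, whose lengths are coprime, and the prefix occurs at
the beginning of each block `φᵐ(a)` for large `m`. -/
theorem IsFixedPoint.eq_one_of_dvd_occurrences (h : IsFixedPoint fibMorphism f) {n D : ℕ}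
    (hD : ∀ i, factor f i n = factor f 0 n → D ∣ i) : D = 1 := by
  let W : ℕ → List Bool → List Bool := fun k => (List.flatMap fibMorphism)^[k]
  have hW : ∀ k v w, W k (v ++ w) = W k v ++ W k w := iterate_flatMap_append _
  have h4 : IsOccurrence f [false, true, false, false] 0 :=
    (h.fib_iterate 3).of_prefix (by simp)
  have hlen : n ≤ (W n [false]).length := by
    have := h.lt_length_iterate fibMorphism_ne_nil h.fib_two_le n
    rw [h.fib_zero] at this
    exact this.le
  have hblock : ∀ v, IsOccurrence f (v ++ [false]) 0 → D ∣ (W n v).length := by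
    intro v hv
    have h1 := h.isOccurrence_iterate hv n
    rw [iterate_flatMap_append] at h1
    have h2 := (IsOccurrence.append_iff.1 h1).2
    have h3 := h.fib_iterate n
    rw [isOccurrence_iff] at h2 h3
    apply hD
    rw [← take_factor f _ hlen, ← take_factor f 0 hlen, ← h3]
    conv_rhs => rw [h2]
    simp [W]
  have ha : D ∣ (W n [false]).length := by
    have h1 := hblock [false, true] (h4.of_prefix (by simp))
    have h2 := hblock ([false, true] ++ [false]) h4
    rw [hW, List.length_append] at h2
    exact (Nat.dvd_add_right h1).1 h2
  have hb : D ∣ (W n [true]).length := by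
    have h1 := hblock ([false] ++ [true]) (h4.of_prefix (by simp))
    rw [hW, List.length_append] at h1
    exact (Nat.dvd_add_right ha).1 h1
  have key : ∀ k, D ∣ (W k [false]).length → D ∣ (W k [true]).length → D = 1 := by
    intro k
    induction k with
    | zero => intro h1 _; simpa [W] using h1
    | succ k ih =>
      intro h1 h2
      have e1 : W (k + 1) [false] = W k [false] ++ W k [true] := by
        rw [← hW]; exact Function.iterate_succ_apply _ _ _
      have e2 : W (k + 1) [true] = W k [false] := Function.iterate_succ_apply _ _ _
      rw [e2] at h2
      rw [e1, List.length_append] at h1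
      exact ih h2 ((Nat.dvd_add_right h2).1 h1)
  exact key n ha hb

end Fibonacci

/-! ### Special factors and edges for the Fibonacci word -/

section FibonacciEdges

variable {f : ℕ → Bool}

theorem bool_set_nontrivial_iff (s : Set Bool) : s.Nontrivial ↔ ∀ x, x ∈ s := by
  constructor
  · rintro ⟨x, hx, y, hy, hxy⟩ z
    cases x <;> cases y <;> cases z <;> simp_all
  · intro h
    exact ⟨false, h _, true, h _, by simp⟩

theorem IsFixedPoint.leftExt_nontrivial_iff (h : IsFixedPoint fibMorphism f) (w : List Bool) :
    (leftExt f w).Nontrivial ↔ w = factor f 0 w.length := by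
  rw [bool_set_nontrivial_iff]
  exact ⟨h.isOccurrence_zero_of_leftSpecial w, h.cons_mem_language_of_isOccurrence_zero⟩

theorem IsFixedPoint.rightExt_nontrivial_iff (h : IsFixedPoint fibMorphism f) (w : List Bool) :
    (rightExt f w).Nontrivial ↔ w = (factor f 0 w.length).reverse := by
  have h1 : rightExt f w = leftExt f w.reverse := by
    ext x
    constructor <;> intro hx
    · simpa [leftExt] using h.reverse_mem_language hx
    · simpa [rightExt] using h.reverse_mem_language hx
  rw [h1, h.leftExt_nontrivial_iff, List.length_reverse, List.reverse_eq_iff]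

theorem IsFixedPoint.isSpecial_iff (h : IsFixedPoint fibMorphism f) (w : List Bool) :
    IsSpecial f w ↔ w = factor f 0 w.length ∨ w = (factor f 0 w.length).reverse := by
  rw [IsSpecial, h.leftExt_nontrivial_iff, h.rightExt_nontrivial_iff]
  refine and_iff_right_of_imp ?_
  rintro (hw | hw) <;> rw [hw]
  · exact factor_mem_language f 0 _
  · exact h.reverse_mem_language (factor_mem_language f 0 _)

/-- The factor of length `n + m` of `f` at position `i` is an edge of the directed graph of
symmetries of order `n`. -/
structure EdgeAt (f : ℕ → Bool) (n i m : ℕ) : Prop where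
  pos : 0 < m
  left : IsSpecial f (factor f i n)
  right : IsSpecial f (factor f (i + m) n)
  inner : ∀ k, 0 < k → k < m → ¬ IsSpecial f (factor f (i + k) n)

variable {n i j m k : ℕ}

theorem IsFixedPoint.isSpecial_factor_iff (h : IsFixedPoint fibMorphism f) :
    IsSpecial f (factor f i n) ↔
      factor f i n = factor f 0 n ∨ factor f i n = (factor f 0 n).reverse := by
  rw [h.isSpecial_iff, length_factor]

theorem IsFixedPoint.exists_reverse (h : IsFixedPoint fibMorphism f) (i n : ℕ) :
    ∃ j, factor f j n = (factor f i n).reverse := by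
  obtain ⟨j, hj⟩ := h.reverse_mem_language (factor_mem_language f i n)
  rw [isOccurrence_iff, List.length_reverse, length_factor] at hj
  exact ⟨j, hj.symm⟩

theorem factor_eq_of_factor_eq {N : ℕ} (h : factor f i N = factor f j N) (hk : k + n ≤ N) :
    factor f (i + k) n = factor f (j + k) n := by
  have h1 := congrArg (List.take (k + n)) h
  rw [take_factor _ _ hk, take_factor _ _ hk, factor_add, factor_add] at h1
  exact (List.append_inj h1 (by simp)).2

theorem factor_of_factor_eq_reverse {N : ℕ} (h : factor f j N = (factor f i N).reverse) {k k' : ℕ}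
    (hk : k + n + k' = N) : factor f (j + k) n = (factor f (i + k') n).reverse := by
  subst hk
  rw [factor_add, factor_add, show k + n + k' = k' + n + k by omega, factor_add, factor_add,
    List.reverse_append, List.reverse_append, ← List.append_assoc] at h
  exact (List.append_inj (List.append_inj h (by simp)).1 (by simp)).2

/-- A factor of length `n` other than the reversed prefix has one right extension only. -/
theorem IsFixedPoint.factor_succ_eq (h : IsFixedPoint fibMorphism f)
    (hij : factor f i n = factor f j n) (hr : factor f i n ≠ (factor f 0 n).reverse) :
    factor f i (n + 1) = factor f j (n + 1) := by
  rw [factor_succ, factor_succ, hij]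
  by_contra hne
  refine hr ?_
  have := (h.rightExt_nontrivial_iff (factor f i n)).1
  rw [length_factor] at this
  refine this ⟨f (i + n), ?_, f (j + n), ?_, fun he => hne (by rw [he])⟩
  · change _ ∈ language f
    rw [← factor_succ]
    exact factor_mem_language _ _ _
  · change _ ∈ language f
    rw [hij, ← factor_succ]
    exact factor_mem_language _ _ _

/-- Two occurrences of a word of length `n + 1` have the same continuation, as long as no right
special factor of length `n` is met. -/
theorem IsFixedPoint.factor_add_eq (h : IsFixedPoint fibMorphism f)
    (hij : factor f i (n + 1) = factor f j (n + 1)) (hm : 0 < m)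
    (hr : ∀ k, 0 < k → k < m → factor f (i + k) n ≠ (factor f 0 n).reverse) :
    factor f i (m + n) = factor f j (m + n) := by
  induction m, hm using Nat.le_induction with
  | base => simpa [add_comm] using hij
  | succ m hm ih =>
    have ih := ih fun k h0 hk => hr k h0 (by omega)
    have h1 : factor f (i + m) n = factor f (j + m) n := factor_eq_of_factor_eq ih le_rfl
    have h2 := h.factor_succ_eq h1 (hr m hm (by omega))
    rw [factor_add, factor_add] at ih
    rw [show m + 1 + n = m + (n + 1) by omega, factor_add f i m (n + 1), h2,
      (List.append_inj ih (by simp)).1, ← factor_add]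

/-- An edge is determined by its prefix of length `n + 1`. -/
theorem EdgeAt.eq_of_factor_succ_eq (h : IsFixedPoint fibMorphism f) {m' : ℕ}
    (he : EdgeAt f n i m) (he' : EdgeAt f n j m')
    (hij : factor f i (n + 1) = factor f j (n + 1)) :
    m = m' ∧ factor f i (m + n) = factor f j (m + n) := by
  have key : ∀ {i j m m'}, EdgeAt f n i m → EdgeAt f n j m' →
      factor f i (n + 1) = factor f j (n + 1) →
      m' ≤ m ∧ factor f i (m + n) = factor f j (m + n) := by
    intro i j m m' he he' hij
    have h1 := h.factor_add_eq hij he.pos fun k h0 hk hr =>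
      he.inner k h0 hk (h.isSpecial_factor_iff.2 (Or.inr hr))
    refine ⟨?_, h1⟩
    by_contra hlt
    have h2 : factor f (i + m) n = factor f (j + m) n := factor_eq_of_factor_eq h1 le_rfl
    exact he'.inner m he.pos (by omega) (h2 ▸ he.right)
  have h1 := key he he' hij
  have h2 := key he' he hij.symm
  exact ⟨le_antisymm h2.1 h1.1, h1.2⟩

theorem IsFixedPoint.isSpecial_reverse_iff (h : IsFixedPoint fibMorphism f) (w : List Bool) :
    IsSpecial f w.reverse ↔ IsSpecial f w := by
  rw [h.isSpecial_iff, h.isSpecial_iff, List.length_reverse, List.reverse_eq_iff,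
    List.reverse_inj, or_comm]

theorem EdgeAt.exists_reverse (h : IsFixedPoint fibMorphism f) (he : EdgeAt f n i m) :
    ∃ j, EdgeAt f n j m ∧ factor f j (m + n) = (factor f i (m + n)).reverse := by
  obtain ⟨j, hj⟩ := h.exists_reverse i (m + n)
  refine ⟨j, ⟨he.pos, ?_, ?_, fun k h0 hk => ?_⟩, hj⟩
  · have := factor_of_factor_eq_reverse (n := n) hj (k := 0) (k' := m) (by omega)
    rw [add_zero] at this
    rw [this, h.isSpecial_reverse_iff]
    exact he.right
  · have := factor_of_factor_eq_reverse (n := n) hj (k := m) (k' := 0) (by omega)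
    rw [add_zero] at this
    rw [this, h.isSpecial_reverse_iff]
    exact he.left
  · have := factor_of_factor_eq_reverse (n := n) hj (k := k) (k' := m - k) (by omega)
    rw [this, h.isSpecial_reverse_iff]
    exact he.inner _ (by omega) (by omega)

/-- Every occurrence `j > 0` of a special factor is the end of an edge, as the prefix of length `n`
is special. -/
theorem IsFixedPoint.exists_edgeAt (h : IsFixedPoint fibMorphism f) (hj : 0 < j)
    (hs : IsSpecial f (factor f j n)) : ∃ i m, i + m = j ∧ EdgeAt f n i m := by
  classical
  let P : ℕ → Prop := fun i => IsSpecial f (factor f i n)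
  have h0 : P 0 := h.isSpecial_factor_iff.2 (Or.inl rfl)
  have h1 := Nat.findGreatest_spec (P := P) (Nat.zero_le (j - 1)) h0
  have h2 := Nat.findGreatest_le (P := P) (j - 1)
  refine ⟨Nat.findGreatest P (j - 1), j - Nat.findGreatest P (j - 1), by omega, by omega, h1, ?_,
    fun k hk hkm => ?_⟩
  · rwa [Nat.add_sub_cancel' (by omega)]
  · exact Nat.findGreatest_is_greatest (P := P) (n := j - 1) (by omega) (by omega)

/-- If the left special factor of length `n` is not right special, then there is only one edge that
starts with it, and this edge ends with the right special factor. -/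
theorem IsFixedPoint.exists_edge_left (h : IsFixedPoint fibMorphism f)
    (hlr : factor f 0 n ≠ (factor f 0 n).reverse) :
    ∃ i₀ m₀, 0 < m₀ ∧ ∀ i m, EdgeAt f n i m → factor f i n = factor f 0 n → m = m₀ ∧
      factor f i (m + n) = factor f i₀ (m + n) ∧
        factor f (i + m) n = (factor f 0 n).reverse := by
  classical
  have hex := h.exists_reverse 0 n
  have hj := Nat.find_spec hex
  have hmin := fun i => Nat.find_min (m := i) hex
  set j := Nat.find hex
  have hj0 : 0 < j := by
    rcases Nat.eq_zero_or_pos j with h0 | h0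
    · rw [h0] at hj; exact absurd hj hlr
    · exact h0
  obtain ⟨i₀, m₀, hij, he₀⟩ := h.exists_edgeAt hj0 (h.isSpecial_factor_iff.2 (Or.inr hj))
  refine ⟨i₀, m₀, he₀.pos, fun i m he hi => ?_⟩
  have hi₀ : factor f i₀ n = factor f 0 n :=
    (h.isSpecial_factor_iff.1 he₀.left).resolve_right (hmin _ (by have := he₀.pos; omega))
  obtain ⟨rfl, h2⟩ := he.eq_of_factor_succ_eq h he₀
    (h.factor_succ_eq (hi.trans hi₀.symm) (hi ▸ hlr))
  have h3 : factor f (i + m) n = factor f (i₀ + m) n := factor_eq_of_factor_eq h2 le_rfl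
  exact ⟨rfl, h2, h3.trans (hij ▸ hj)⟩

/-- An edge that starts with the right special factor ends with the left special one. -/
theorem EdgeAt.right_eq_of_left_eq_reverse (h : IsFixedPoint fibMorphism f)
    (he : EdgeAt f n i m) (hi : factor f i n = (factor f 0 n).reverse) :
    factor f (i + m) n = factor f 0 n := by
  refine (h.isSpecial_factor_iff.1 he.right).elim id fun h1 => ?_
  by_cases hlr : factor f 0 n = (factor f 0 n).reverse
  · exact h1.trans hlr.symm
  obtain ⟨i₀, m₀, _, hleft⟩ := h.exists_edge_left hlr
  obtain ⟨j, hej, hj⟩ := he.exists_reverse h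
  have hjs : factor f j n = (factor f (i + m) n).reverse := by
    simpa using factor_of_factor_eq_reverse (n := n) hj (k := 0) (k' := m) (by omega)
  have hjr : factor f (j + m) n = (factor f i n).reverse := by
    simpa using factor_of_factor_eq_reverse (n := n) hj (k := m) (k' := 0) (by omega)
  rw [h1, List.reverse_reverse] at hjs
  have h2 := (hleft j m hej hjs).2.2
  rw [hjr, hi, List.reverse_reverse] at h2
  exact absurd h2 hlr

/-- Every edge of a directed graph of symmetries of the Fibonacci word is a palindrome. Reversal
maps edges to edges. Let `l` be the left special and `r` the right special factor of length `n`. If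
`l ≠ r`, there is only one edge from `l`, so it is a palindrome, and all other edges lead from `r`
to `l`. An edge from `r` to `l` that is not a palindrome would, together with its reversal, exhaust
the edges from `r`; then all these edges would have the same length, so the occurrences of `l` would
be the multiples of a number `D`. Hence `D = 1`, which is possible only if the edge is a power of a
letter, and so a palindrome. -/
theorem EdgeAt.reverse_eq (h : IsFixedPoint fibMorphism f) (he : EdgeAt f n i m) :
    (factor f i (m + n)).reverse = factor f i (m + n) := by
  by_contra hpal
  obtain ⟨j, hej, hj⟩ := he.exists_reverse h
  have hjs : factor f j n = (factor f (i + m) n).reverse := by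
    simpa using factor_of_factor_eq_reverse (n := n) hj (k := 0) (k' := m) (by omega)
  have hne : factor f j (n + 1) ≠ factor f i (n + 1) := fun heq =>
    hpal (hj ▸ (hej.eq_of_factor_succ_eq h he heq).2)
  have hi : factor f i n = (factor f 0 n).reverse := by
    refine (h.isSpecial_factor_iff.1 he.left).elim (fun hi => ?_) id
    by_cases hlr : factor f 0 n = (factor f 0 n).reverse
    · exact hi.trans hlr
    obtain ⟨i₀, m₀, _, hleft⟩ := h.exists_edge_left hlr
    rw [(hleft i m he hi).2.2, List.reverse_reverse] at hjs
    exact absurd (h.factor_succ_eq (hjs.trans hi.symm) (hjs ▸ hlr)) hne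
  have hil := he.right_eq_of_left_eq_reverse h hi
  rw [hil] at hjs
  -- Over a two-letter alphabet, an edge from `r` continues like `e` or like the reversal of `e`.
  have hlen : ∀ i' m', EdgeAt f n i' m' → factor f i' n = (factor f 0 n).reverse → m' = m := by
    intro i' m' he' hi'
    rw [factor_succ, factor_succ, hjs, hi] at hne
    have hne' : f (j + n) ≠ f (i + n) := fun h => hne (by rw [h])
    by_cases hc : f (i' + n) = f (i + n)
    · exact (he'.eq_of_factor_succ_eq h he (by rw [factor_succ, factor_succ, hi, hi', hc])).1
    · have hc' : f (i' + n) = f (j + n) := by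
        revert hc hne'
        cases f (i' + n) <;> cases f (i + n) <;> cases f (j + n) <;> simp
      exact (he'.eq_of_factor_succ_eq h hej (by rw [factor_succ, factor_succ, hjs, hi', hc'])).1
  by_cases hlr : factor f 0 n = (factor f 0 n).reverse
  · have hdvd : ∀ j, factor f j n = factor f 0 n → m ∣ j := by
      intro j
      induction j using Nat.strong_induction_on with
      | _ j ih =>
        intro hj
        rcases Nat.eq_zero_or_pos j with rfl | hj0
        · exact dvd_zero m
        · obtain ⟨i', m', hij, he'⟩ := h.exists_edgeAt hj0 (h.isSpecial_factor_iff.2 (Or.inl hj))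
          have h1 := h.isSpecial_factor_iff.1 he'.left
          rw [← hlr, or_self] at h1
          have h2 := hlen i' m' he' (h1.trans hlr)
          have h3 := he.pos
          rw [← hij, h2]
          exact (ih i' (by omega) h1).add (dvd_refl m)
    have hm := h.eq_one_of_dvd_occurrences hdvd
    -- A word `c l = l d` has `c = d`, by comparing numbers of letters.
    subst hm
    have e1 := factor_succ' f i n
    rw [factor_succ, hil, hi, ← hlr] at e1
    have hcd : f (i + n) = f i := by
      have h1 := congrArg (List.count (f i)) e1
      by_contra hcd
      simp [List.count_append, hcd] at h1
    rw [add_comm 1 n, factor_succ, hi, ← hlr] at hpal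
    apply hpal
    rw [List.reverse_append, ← hlr, e1, hcd]
    rfl
  · obtain ⟨i₀, m₀, hm₀, hleft⟩ := h.exists_edge_left hlr
    have hm : m₀ + m = 1 := by
      refine h.eq_one_of_dvd_occurrences (f := f) (n := n) fun j => ?_
      induction j using Nat.strong_induction_on with
      | _ j ih =>
        intro hj
        rcases Nat.eq_zero_or_pos j with rfl | hj0
        · exact dvd_zero _
        -- The last edge before `j` leads from `r` to `l`, the one before it from `l` to `r`.
        obtain ⟨i₁, m₁, hij, he₁⟩ := h.exists_edgeAt hj0 (h.isSpecial_factor_iff.2 (Or.inl hj))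
        have hi₁ : factor f i₁ n = (factor f 0 n).reverse := by
          refine (h.isSpecial_factor_iff.1 he₁.left).resolve_left fun hi₁ => ?_
          have h3 := (hleft i₁ m₁ he₁ hi₁).2.2
          rw [hij, hj] at h3
          exact hlr h3
        have hm₁ := hlen i₁ m₁ he₁ hi₁
        have hi₁0 : 0 < i₁ := by
          rcases Nat.eq_zero_or_pos i₁ with rfl | h0
          · exact absurd hi₁ hlr
          · exact h0
        obtain ⟨i₂, m₂, hij₂, he₂⟩ := h.exists_edgeAt hi₁0 he₁.left
        have hi₂ : factor f i₂ n = factor f 0 n := by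
          refine (h.isSpecial_factor_iff.1 he₂.left).resolve_right fun hi₂ => ?_
          have h3 := he₂.right_eq_of_left_eq_reverse h hi₂
          rw [hij₂, hi₁] at h3
          exact hlr h3.symm
        have hm₂ := (hleft i₂ m₂ he₂ hi₂).1
        rw [← hij, ← hij₂, hm₁, hm₂, add_assoc]
        exact (ih i₂ (by omega) hi₂).add (dvd_refl _)
    have := he.pos
    omega

end FibonacciEdges

/-! ### The group of symmetries -/

section Group

/-- The group `ℤ₂ × ℤ₂ × ℤ₂`, written multiplicatively; it indexes the elements of `groupG`. -/
abbrev SymIndex : Type := Multiplicative (ZMod 2 × ZMod 2 × ZMod 2)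

/-- The index of the generator `Θ₀`. -/
def symIndex0 : SymIndex := Multiplicative.ofAdd (1, 0, 0)

/-- The index of the generator `Θ₁`. -/
def symIndex1 : SymIndex := Multiplicative.ofAdd (0, 1, 0)

/-- The index of the generator `Θ₂`. -/
def symIndex2 : SymIndex := Multiplicative.ofAdd (0, 0, 1)

/-- The permutation of the letters that underlies an element of `groupG`. -/
def letterPerm : SymIndex →* Equiv.Perm (Fin 8) where
  toFun x := sigma0 ^ x.toAdd.1.val * sigma1 ^ x.toAdd.2.1.val * sigma2 ^ x.toAdd.2.2.val
  map_one' := by decide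
  map_mul' := by decide

/-- The number modulo 2 of antimorphisms in a product of generators; it is `1` for the
antimorphisms and `0` for the morphisms. -/
def signExp (x : SymIndex) : ZMod 2 := x.toAdd.1 + x.toAdd.2.1 + x.toAdd.2.2

theorem signExp_mul (x y : SymIndex) : signExp (x * y) = signExp x + signExp y := by
  simp only [signExp, toAdd_mul, Prod.fst_add, Prod.snd_add]
  ring

theorem signExp_eq_zero_or_one (x : SymIndex) : signExp x = 0 ∨ signExp x = 1 := by
  generalize signExp x = a
  revert a
  decide

/-- The element of `groupG` with a given index: a permutation of the letters, followed by reversal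
in the case of an antimorphism. -/
def symHom : SymIndex →* Equiv.Perm (List (Fin 8)) where
  toFun x :=
    { toFun w := if signExp x = 0 then w.map (letterPerm x) else (w.map (letterPerm x)).reverse
      invFun w := if signExp x = 0 then w.map (letterPerm x).symm
        else (w.map (letterPerm x).symm).reverse
      left_inv w := by split_ifs <;> simp
      right_inv w := by split_ifs <;> simp }
  map_one' := by
    ext1 w
    have : signExp 1 = 0 := rfl
    simp [this]
  map_mul' x y := by
    ext1 w
    have h1 : (1 : ZMod 2) + 1 = 0 := rfl
    simp only [Equiv.coe_fn_mk, Equiv.Perm.coe_mul, Function.comp_apply, signExp_mul]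
    rcases signExp_eq_zero_or_one x with hx | hx <;>
      rcases signExp_eq_zero_or_one y with hy | hy <;> simp [hx, hy, h1]

variable {x : SymIndex}

theorem symHom_apply_of_zero (hx : signExp x = 0) (w : List (Fin 8)) :
    symHom x w = w.map (letterPerm x) := if_pos hx

theorem symHom_apply_of_one (hx : signExp x = 1) (w : List (Fin 8)) :
    symHom x w = (w.map (letterPerm x)).reverse := if_neg (by simp [hx])

theorem isMorphism_symHom (hx : signExp x = 0) : IsMorphism (symHom x) := fun v w => by
  simp [symHom_apply_of_zero hx]

theorem isAntimorphism_symHom (hx : signExp x = 1) : IsAntimorphism (symHom x) := fun v w => by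
  simp [symHom_apply_of_one hx]

theorem symHom_symIndex0 : symHom symIndex0 = letterAntimorphism sigma0 := by
  ext1 w
  have h : letterPerm symIndex0 = sigma0 := by decide
  rw [symHom_apply_of_one rfl, h]
  rfl

theorem symHom_symIndex1 : symHom symIndex1 = letterAntimorphism sigma1 := by
  ext1 w
  have h : letterPerm symIndex1 = sigma1 := by decide
  rw [symHom_apply_of_one rfl, h]
  rfl

theorem symHom_symIndex2 : symHom symIndex2 = letterAntimorphism sigma2 := by
  ext1 w
  have h : letterPerm symIndex2 = sigma2 := by decide
  rw [symHom_apply_of_one rfl, h]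
  rfl

theorem groupG_eq_range : groupG = symHom.range := by
  have hgen : Subgroup.closure {symIndex0, symIndex1, symIndex2} = ⊤ := by
    refine eq_top_iff.2 fun x _ => ?_
    have hx : ∀ x : SymIndex, x = symIndex0 ^ x.toAdd.1.val * symIndex1 ^ x.toAdd.2.1.val *
        symIndex2 ^ x.toAdd.2.2.val := by decide
    rw [hx x]
    exact mul_mem (mul_mem (pow_mem (Subgroup.subset_closure (by simp)) _)
      (pow_mem (Subgroup.subset_closure (by simp)) _))
      (pow_mem (Subgroup.subset_closure (by simp)) _)
  rw [MonoidHom.range_eq_map, ← hgen, MonoidHom.map_closure, groupG, Set.image_insert_eq,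
    Set.image_insert_eq, Set.image_singleton, symHom_symIndex0, symHom_symIndex1, symHom_symIndex2]

theorem mem_groupG_iff {g : Equiv.Perm (List (Fin 8))} : g ∈ groupG ↔ ∃ x, symHom x = g := by
  rw [groupG_eq_range, MonoidHom.mem_range]

theorem symHom_mem_groupG (x : SymIndex) : symHom x ∈ groupG := mem_groupG_iff.2 ⟨x, rfl⟩

theorem symHom_singleton (x : SymIndex) (a : Fin 8) : symHom x [a] = [letterPerm x a] := by
  rcases signExp_eq_zero_or_one x with hx | hx
  · simp [symHom_apply_of_zero hx]
  · simp [symHom_apply_of_one hx]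

theorem symHom_injective : Function.Injective symHom := by
  have hinj : ∀ x, letterPerm x = 1 → x = 1 := by decide
  refine (injective_iff_map_eq_one _).2 fun x hx => hinj x ?_
  ext1 a
  have := symHom_singleton x a
  rw [hx] at this
  simpa using this.symm

theorem isSymmetryGroup_groupG : IsSymmetryGroup groupG where
  finite := by
    rw [groupG_eq_range]
    exact inferInstanceAs (Finite (Set.range symHom))
  morphism_or_antimorphism g hg := by
    obtain ⟨x, rfl⟩ := mem_groupG_iff.1 hg
    exact (signExp_eq_zero_or_one x).imp isMorphism_symHom isAntimorphism_symHom
  exists_antimorphism := ⟨_, symHom_mem_groupG symIndex0, isAntimorphism_symHom rfl⟩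

theorem nonempty_groupG_mulEquiv : Nonempty (groupG ≃* SymIndex) := by
  rw [groupG_eq_range]
  exact ⟨(MonoidHom.ofInjective symHom_injective).symm⟩

theorem IsGPalindrome.apply {w : List (Fin 8)} (hw : IsGPalindrome groupG w)
    {g : Equiv.Perm (List (Fin 8))} (hg : g ∈ groupG) : IsGPalindrome groupG (g w) := by
  obtain ⟨t, ht, hanti, htw⟩ := hw
  obtain ⟨x, rfl⟩ := mem_groupG_iff.1 hg
  obtain ⟨y, rfl⟩ := mem_groupG_iff.1 ht
  refine ⟨_, ht, hanti, ?_⟩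
  rw [← Equiv.Perm.mul_apply, ← map_mul, mul_comm, map_mul, Equiv.Perm.mul_apply, htw]

end Group

/-! ### Projection to the Fibonacci word -/

section Projection

/-- The parity of a letter, `true` for the odd letters. It maps the morphism `phi` to the Fibonacci
morphism. -/
def parity (a : Fin 8) : Bool := decide (a.val % 2 = 1)

theorem phi_ne_nil : ∀ a, phi a ≠ [] := by decide

theorem map_parity_flatMap (w : List (Fin 8)) :
    (w.flatMap phi).map parity = (w.map parity).flatMap fibMorphism := by
  have h : ∀ a, (phi a).map parity = fibMorphism (parity a) := by decide
  induction w with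
  | nil => rfl
  | cons a w ih => rw [List.flatMap_cons, List.map_append, ih, h, List.map_cons, List.flatMap_cons]

/-- The pairs of letters `a`, `b` such that `ab` is a factor of the fixed point of `phi`. -/
def IsPair (a b : Fin 8) : Prop :=
  (a, b) ∈ [((0 : Fin 8), (1 : Fin 8)), (0, 4), (1, 2), (2, 3), (2, 6), (3, 0), (4, 0), (4, 7),
    (5, 4), (6, 2), (6, 5), (7, 6)]

instance : DecidableRel IsPair := fun _ _ => inferInstanceAs (Decidable (_ ∈ _))

theorem IsPair.right_inj : ∀ {a b c}, IsPair a b → IsPair a c → parity b = parity c → b = c := by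
  decide

theorem IsPair.left_inj : ∀ {a b c}, IsPair a c → IsPair b c → parity a = parity b → a = b := by
  decide

theorem isChain_flatMap_phi {w : List (Fin 8)} (h : w.IsChain IsPair) :
    (w.flatMap phi).IsChain IsPair := by
  have h1 : ∀ a, (phi a).IsChain IsPair := by decide
  have h2 : ∀ a b, IsPair a b → ∀ c ∈ (phi a).getLast?, ∀ d ∈ (phi b).head?, IsPair c d := by
    decide
  have h3 : [] ∉ w.map phi := fun hm =>
    let ⟨a, _, ha⟩ := List.mem_map.1 hm
    phi_ne_nil a ha
  rw [List.flatMap_def, List.isChain_flatten h3]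
  refine ⟨fun l hl => ?_, ?_⟩
  · obtain ⟨a, _, rfl⟩ := List.mem_map.1 hl
    exact h1 a
  rw [List.isChain_map]
  exact h.imp fun a b => h2 a b

/-- A word all of whose factors of length 2 are factors of the fixed point is determined by its
first letter and the parities of its letters. -/
theorem eq_of_isChain {v w : List (Fin 8)} (hv : v.IsChain IsPair) (hw : w.IsChain IsPair)
    (hp : v.map parity = w.map parity) (h0 : v.head? = w.head?) : v = w := by
  induction v generalizing w with
  | nil => exact (List.map_eq_nil_iff.1 hp.symm).symm
  | cons a v ih =>
    cases w with
    | nil => simp at hp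
    | cons b w =>
      simp only [List.head?_cons, Option.some.injEq] at h0
      subst h0
      simp only [List.map_cons, List.cons.injEq, true_and] at hp
      refine congrArg _ (ih hv.tail hw.tail hp ?_)
      cases v with
      | nil => rw [List.map_nil, eq_comm, List.map_eq_nil_iff] at hp; rw [hp]
      | cons c v =>
        cases w with
        | nil => simp at hp
        | cons d w =>
          simp only [List.map_cons, List.cons.injEq] at hp
          rw [List.isChain_cons_cons] at hv hw
          rw [List.head?_cons, List.head?_cons, hv.1.right_inj hw.1 hp.1]

theorem parity_letterPerm : ∀ x a, parity (letterPerm x a) = parity a := by decide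

theorem map_parity_symHom_of_zero {x : SymIndex} (hx : signExp x = 0) (w : List (Fin 8)) :
    (symHom x w).map parity = w.map parity := by
  simp [symHom_apply_of_zero hx, Function.comp_def, parity_letterPerm]

theorem map_parity_symHom_of_one {x : SymIndex} (hx : signExp x = 1) (w : List (Fin 8)) :
    (symHom x w).map parity = (w.map parity).reverse := by
  simp [symHom_apply_of_one hx, Function.comp_def, parity_letterPerm]

theorem isChain_symHom (x : SymIndex) {w : List (Fin 8)} (hw : w.IsChain IsPair) :
    (symHom x w).IsChain IsPair := by
  have h0 : ∀ x, signExp x = 0 → ∀ a b, IsPair a b → IsPair (letterPerm x a) (letterPerm x b) := by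
    decide
  have h1 : ∀ x, signExp x = 1 → ∀ a b, IsPair a b → IsPair (letterPerm x b) (letterPerm x a) := by
    decide
  rcases signExp_eq_zero_or_one x with hx | hx
  · rw [symHom_apply_of_zero hx, List.isChain_map]
    exact hw.imp (h0 x hx)
  · rw [symHom_apply_of_one hx, List.isChain_reverse, List.isChain_map]
    exact hw.imp (h1 x hx)

/-- The morphisms in `groupG` act transitively on the letters of each parity. -/
theorem exists_letterPerm_eq : ∀ a b, parity a = parity b →
    ∃ x, signExp x = 0 ∧ letterPerm x a = b := by decide

theorem exists_symHom_eq {v w : List (Fin 8)} (hv : v.IsChain IsPair) (hw : w.IsChain IsPair)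
    (hp : v.map parity = w.map parity) : ∃ x, signExp x = 0 ∧ symHom x v = w := by
  cases v with
  | nil =>
    cases w with
    | nil => exact ⟨1, rfl, rfl⟩
    | cons b w => simp at hp
  | cons a v =>
    cases w with
    | nil => simp at hp
    | cons b w =>
      obtain ⟨x, hx, hab⟩ := exists_letterPerm_eq a b (List.cons.inj hp).1
      refine ⟨x, hx, eq_of_isChain (isChain_symHom x hv) hw ?_ ?_⟩
      · rw [map_parity_symHom_of_zero hx, hp]
      · simp [symHom_apply_of_zero hx, hab]

/-- `phi` intertwines the morphisms in `groupG`, up to an automorphism of the group of these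
morphisms. -/
theorem exists_symHom_flatMap {x : SymIndex} (hx : signExp x = 0) : ∃ y, signExp y = 0 ∧
    ∀ w, symHom x (w.flatMap phi) = (symHom y w).flatMap phi := by
  have h : ∀ x, signExp x = 0 → ∃ y, signExp y = 0 ∧
      ∀ a, (phi a).map (letterPerm x) = phi (letterPerm y a) := by decide
  obtain ⟨y, hy, hxy⟩ := h x hx
  refine ⟨y, hy, fun w => ?_⟩
  rw [symHom_apply_of_zero hx, symHom_apply_of_zero hy]
  simp only [List.map_flatMap, List.flatMap_map, hxy]

variable {u : ℕ → Fin 8}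

theorem IsFixedPoint.phi_zero (h : IsFixedPoint phi u) : u 0 = 0 := by
  have h0 : ∀ a, (phi a).head? = some a → a = 0 := by decide
  exact h0 _ (h.head?_eq (phi_ne_nil _))

theorem IsFixedPoint.phi_two_le (h : IsFixedPoint phi u) : 2 ≤ (phi (u 0)).length := by
  simp [h.phi_zero, phi]

theorem existsUnique_isFixedPoint_phi : ∃! u, IsFixedPoint phi u := by
  obtain ⟨u, hu⟩ := exists_isFixedPoint phi_ne_nil (a := 0) (t := [1]) rfl (by simp)
  refine ⟨u, hu, fun v hv => ?_⟩
  exact hv.eq_of_apply_zero_eq hu phi_ne_nil hv.phi_two_le (hv.phi_zero.trans hu.phi_zero.symm)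

theorem prefixWord_parity (u : ℕ → Fin 8) (n : ℕ) :
    prefixWord (fun k => parity (u k)) n = (prefixWord u n).map parity := by
  rw [prefixWord_eq_factor, prefixWord_eq_factor, map_factor]

theorem IsFixedPoint.fib_parity (h : IsFixedPoint phi u) :
    IsFixedPoint fibMorphism fun k => parity (u k) := by
  intro n
  rw [prefixWord_parity, ← map_parity_flatMap, h n, prefixWord_parity]
  simp [prefixWord]

theorem map_parity_mem_language {w : List (Fin 8)} (hw : w ∈ language u) :
    w.map parity ∈ language fun k => parity (u k) := by
  obtain ⟨i, hi⟩ := hw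
  rw [isOccurrence_iff.1 hi, map_factor]
  exact factor_mem_language _ _ _

theorem exists_map_parity_eq {p : List Bool} (hp : p ∈ language fun k => parity (u k)) :
    ∃ w ∈ language u, w.map parity = p := by
  obtain ⟨i, hi⟩ := hp
  refine ⟨factor u i p.length, factor_mem_language _ _ _, ?_⟩
  rw [map_factor]
  exact (isOccurrence_iff.1 hi).symm

theorem IsFixedPoint.isChain (h : IsFixedPoint phi u) {w : List (Fin 8)} (hw : w ∈ language u) :
    w.IsChain IsPair := by
  obtain ⟨k, hk⟩ := h.exists_infix_iterate phi_ne_nil h.phi_two_le hw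
  refine List.IsChain.infix ?_ hk
  clear hk
  induction k with
  | zero => simp
  | succ k ih => rw [Function.iterate_succ_apply']; exact isChain_flatMap_phi ih

theorem IsFixedPoint.singleton_mem_language (h : IsFixedPoint phi u) (a : Fin 8) :
    [a] ∈ language u := by
  have h1 := h.isOccurrence_iterate (isOccurrence_singleton u 0) 7
  rw [h.phi_zero] at h1
  have h2 : ∀ a, a ∈ (List.flatMap phi)^[7] [0] := by decide
  obtain ⟨s, t, hst⟩ := List.append_of_mem (h2 a)
  exact mem_language_of_infix ⟨s, t, by rw [hst]; simp⟩ ⟨0, h1⟩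

theorem IsFixedPoint.symHom_mem_language_of_zero (h : IsFixedPoint phi u) {x : SymIndex}
    (hx : signExp x = 0) {w : List (Fin 8)} (hw : w ∈ language u) : symHom x w ∈ language u := by
  have key : ∀ k x, signExp x = 0 → symHom x ((List.flatMap phi)^[k] [u 0]) ∈ language u := by
    have : ∀ k x, signExp x = 0 → ∃ y, signExp y = 0 ∧
        ∀ v, symHom x ((List.flatMap phi)^[k] v) = (List.flatMap phi)^[k] (symHom y v) := by
      intro k
      induction k with
      | zero => exact fun x hx => ⟨x, hx, fun _ => rfl⟩
      | succ k ih =>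
        intro x hx
        obtain ⟨y, hy, hxy⟩ := exists_symHom_flatMap hx
        obtain ⟨z, hz, hyz⟩ := ih y hy
        refine ⟨z, hz, fun v => ?_⟩
        rw [Function.iterate_succ_apply', hxy, hyz, Function.iterate_succ_apply']
    intro k x hx
    obtain ⟨y, hy, hxy⟩ := this k x hx
    rw [hxy, symHom_singleton]
    exact h.iterate_mem_language (h.singleton_mem_language _) k
  obtain ⟨k, hk⟩ := h.exists_infix_iterate phi_ne_nil h.phi_two_le hw
  refine mem_language_of_infix ?_ (key k x hx)
  rw [symHom_apply_of_zero hx, symHom_apply_of_zero hx]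
  exact hk.map _

/-- The language of the fixed point consists of the words with admissible pairs of letters whose
parities form a factor of the Fibonacci word. -/
theorem IsFixedPoint.mem_language_iff_parity (h : IsFixedPoint phi u) {w : List (Fin 8)} :
    w ∈ language u ↔ w.IsChain IsPair ∧ w.map parity ∈ language fun k => parity (u k) := by
  refine ⟨fun hw => ⟨h.isChain hw, map_parity_mem_language hw⟩, fun ⟨hw, hp⟩ => ?_⟩
  obtain ⟨v, hv, hvw⟩ := exists_map_parity_eq hp
  obtain ⟨x, hx, rfl⟩ := exists_symHom_eq (h.isChain hv) hw hvw
  exact h.symHom_mem_language_of_zero hx hv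

theorem IsFixedPoint.symHom_mem_language (h : IsFixedPoint phi u) (x : SymIndex)
    {w : List (Fin 8)} (hw : w ∈ language u) : symHom x w ∈ language u := by
  rw [h.mem_language_iff_parity] at hw ⊢
  refine ⟨isChain_symHom x hw.1, ?_⟩
  rcases signExp_eq_zero_or_one x with hx | hx
  · rw [map_parity_symHom_of_zero hx]
    exact hw.2
  · rw [map_parity_symHom_of_one hx]
    exact h.fib_parity.reverse_mem_language hw.2

theorem IsFixedPoint.isClosedUnder (h : IsFixedPoint phi u) : IsClosedUnder groupG u := by
  intro g hg w hw
  obtain ⟨x, rfl⟩ := mem_groupG_iff.1 hg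
  exact h.symHom_mem_language x hw

/-- Extensions of a factor can be lifted from the Fibonacci word. -/
theorem IsFixedPoint.exists_lift (h : IsFixedPoint phi u) {w : List (Fin 8)} (hw : w ∈ language u)
    {p q : List Bool} (hpq : p ++ w.map parity ++ q ∈ language fun k => parity (u k)) :
    ∃ s t, s.map parity = p ∧ t.map parity = q ∧ s ++ w ++ t ∈ language u := by
  obtain ⟨v, hv, hvp⟩ := exists_map_parity_eq hpq
  obtain ⟨v', t, rfl, hv', rfl⟩ := List.map_eq_append_iff.1 hvp
  obtain ⟨s, m, rfl, rfl, hm⟩ := List.map_eq_append_iff.1 hv'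
  have hmL : m ∈ language u :=
    mem_language_of_infix ⟨s, t, rfl⟩ hv
  obtain ⟨x, hx, rfl⟩ := exists_symHom_eq (h.isChain hmL) (h.isChain hw) hm
  refine ⟨symHom x s, symHom x t, map_parity_symHom_of_zero hx s, map_parity_symHom_of_zero hx t,
    ?_⟩
  rw [← isMorphism_symHom hx, ← isMorphism_symHom hx]
  exact h.symHom_mem_language x hv

theorem IsFixedPoint.leftExt_nontrivial_parity_iff (h : IsFixedPoint phi u) {w : List (Fin 8)}
    (hw : w ∈ language u) (hne : w ≠ []) : (leftExt u w).Nontrivial ↔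
      (leftExt (fun k => parity (u k)) (w.map parity)).Nontrivial := by
  constructor
  · rintro ⟨a, ha, b, hb, hab⟩
    refine ⟨_, map_parity_mem_language ha, _, map_parity_mem_language hb, fun he => hab ?_⟩
    obtain ⟨c, w, rfl⟩ := List.exists_cons_of_ne_nil hne
    exact (List.isChain_cons_cons.1 (h.isChain ha)).1.left_inj
      (List.isChain_cons_cons.1 (h.isChain hb)).1 he
  · have key : ∀ p ∈ leftExt (fun k => parity (u k)) (w.map parity),
        ∃ a ∈ leftExt u w, parity a = p := by
      intro p hp
      obtain ⟨s, t, hs, ht, hL⟩ := h.exists_lift hw (p := [p]) (q := [])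
        (by simpa [leftExt] using hp)
      obtain ⟨a, rfl, ha⟩ := List.map_eq_singleton_iff.1 hs
      obtain rfl := List.map_eq_nil_iff.1 ht
      exact ⟨a, by simpa [leftExt] using hL, ha⟩
    rintro ⟨p, hp, q, hq, hpq⟩
    obtain ⟨a, ha, rfl⟩ := key p hp
    obtain ⟨b, hb, rfl⟩ := key q hq
    exact ⟨a, ha, b, hb, fun he => hpq (by rw [he])⟩

theorem IsFixedPoint.rightExt_nontrivial_parity_iff (h : IsFixedPoint phi u) {w : List (Fin 8)}
    (hw : w ∈ language u) (hne : w ≠ []) : (rightExt u w).Nontrivial ↔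
      (rightExt (fun k => parity (u k)) (w.map parity)).Nontrivial := by
  constructor
  · rintro ⟨a, ha, b, hb, hab⟩
    refine ⟨parity a, by simpa [rightExt] using map_parity_mem_language ha, parity b,
      by simpa [rightExt] using map_parity_mem_language hb, fun he => hab ?_⟩
    obtain ⟨v, c, rfl⟩ := (List.eq_nil_or_concat' w).resolve_left hne
    have hpair : ∀ a ∈ rightExt u (v ++ [c]), IsPair c a := fun a ha =>
      List.isChain_pair.1 (h.isChain (mem_language_of_infix (w := [c, a]) ⟨v, [], by simp⟩ ha))
    exact (hpair a ha).right_inj (hpair b hb) he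
  · have key : ∀ p ∈ rightExt (fun k => parity (u k)) (w.map parity),
        ∃ a ∈ rightExt u w, parity a = p := by
      intro p hp
      obtain ⟨s, t, hs, ht, hL⟩ := h.exists_lift hw (p := []) (q := [p])
        (by simpa [rightExt] using hp)
      obtain ⟨a, rfl, ha⟩ := List.map_eq_singleton_iff.1 ht
      obtain rfl := List.map_eq_nil_iff.1 hs
      exact ⟨a, by simpa [rightExt] using hL, ha⟩
    rintro ⟨p, hp, q, hq, hpq⟩
    obtain ⟨a, ha, rfl⟩ := key p hp
    obtain ⟨b, hb, rfl⟩ := key q hq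
    exact ⟨a, ha, b, hb, fun he => hpq (by rw [he])⟩

theorem IsFixedPoint.isSpecial_parity_iff (h : IsFixedPoint phi u) {w : List (Fin 8)}
    (hw : w ∈ language u) (hne : w ≠ []) :
    IsSpecial u w ↔ IsSpecial (fun k => parity (u k)) (w.map parity) := by
  rw [IsSpecial, IsSpecial, h.leftExt_nontrivial_parity_iff hw hne,
    h.rightExt_nontrivial_parity_iff hw hne]
  exact and_congr_left fun _ => ⟨fun _ => map_parity_mem_language hw, fun _ => hw⟩

theorem IsFixedPoint.isSpecial_factor_parity_iff (h : IsFixedPoint phi u) {n : ℕ} (hn : 1 ≤ n)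
    (i : ℕ) : IsSpecial u (factor u i n) ↔
      IsSpecial (fun k => parity (u k)) (factor (fun k => parity (u k)) i n) := by
  rw [h.isSpecial_parity_iff (factor_mem_language u i n), map_factor]
  refine List.ne_nil_of_length_pos ?_
  rwa [length_factor]

end Projection

/-! ### Richness -/

section Richness

variable {u : ℕ → Fin 8} {n : ℕ}

theorem IsFixedPoint.exists_edgeAt_parity (h : IsFixedPoint phi u) (hn : 1 ≤ n)
    {e : List (Fin 8)} (he : IsEdgeWord u n e) : ∃ i m, e = factor u i (m + n) ∧
      EdgeAt (fun k => parity (u k)) n i m := by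
  obtain ⟨⟨i, hi⟩, hlt, hpre, hsuf, hin⟩ := he
  obtain ⟨m, hm⟩ := Nat.exists_eq_add_of_le' hlt.le
  rw [isOccurrence_iff, hm] at hi
  have hdrop : ∀ k, k ≤ m → (e.drop k).take n = factor u (i + k) n := by
    intro k hk
    rw [hi, show m + n = k + (n + (m - k)) by omega, drop_factor,
      take_factor _ _ (Nat.le_add_right _ _)]
  have hsuf' : suffixWord e n = factor u (i + m) n := by
    rw [suffixWord, hm, Nat.add_sub_cancel, hi, drop_factor]
  refine ⟨i, m, hi, by omega, ?_, ?_, fun k h0 hk => ?_⟩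
  · have := hdrop 0 (Nat.zero_le _)
    rw [List.drop_zero, add_zero] at this
    rwa [← h.isSpecial_factor_parity_iff hn, ← this]
  · rwa [← h.isSpecial_factor_parity_iff hn, ← hsuf']
  · rw [← h.isSpecial_factor_parity_iff hn, ← hdrop k hk.le]
    exact hin k h0 (by omega)

/-- The edges of the directed graphs of symmetries project to palindromes, and every symmetry of the
projection lifts. -/
theorem IsFixedPoint.isGPalindrome_of_isEdgeWord (h : IsFixedPoint phi u) (hn : 1 ≤ n)
    {e : List (Fin 8)} (he : IsEdgeWord u n e) : IsGPalindrome groupG e := by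
  obtain ⟨i, m, hi, hE⟩ := h.exists_edgeAt_parity hn he
  have hpal := hE.reverse_eq h.fib_parity
  rw [← map_factor, ← hi] at hpal
  have he' := h.symHom_mem_language symIndex0 he.mem_language
  obtain ⟨x, hx, hxe⟩ := exists_symHom_eq (h.isChain he') (h.isChain he.mem_language)
    ((map_parity_symHom_of_one rfl e).trans hpal)
  refine ⟨symHom (x * symIndex0), symHom_mem_groupG _, isAntimorphism_symHom ?_, ?_⟩
  · rw [signExp_mul, hx]; rfl
  · rw [map_mul, Equiv.Perm.mul_apply, hxe]

/-- A graph of symmetries has one vertex only. -/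
theorem IsFixedPoint.wordClass_eq_of_isSpecial (h : IsFixedPoint phi u) {v w : List (Fin 8)}
    (hv : IsSpecial u v) (hw : IsSpecial u w) (hlen : v.length = w.length) (hne : v ≠ []) :
    wordClass groupG v = wordClass groupG w := by
  have hne' : w ≠ [] := by rintro rfl; exact hne (List.length_eq_zero_iff.1 hlen)
  have h1 := (h.isSpecial_parity_iff hv.1 hne).1 hv
  have h2 := (h.isSpecial_parity_iff hw.1 hne').1 hw
  rw [h.fib_parity.isSpecial_iff, List.length_map] at h1 h2
  rw [← hlen] at h2
  have h3 : w.map parity = v.map parity ∨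
      w.map parity = (v.map parity).reverse := by
    rcases h1 with h1 | h1 <;> rcases h2 with h2 | h2 <;> rw [h1, h2] <;> simp
  rcases h3 with h3 | h3
  · obtain ⟨x, _, rfl⟩ := exists_symHom_eq (h.isChain hv.1) (h.isChain hw.1) h3.symm
    rw [wordClass_apply (symHom_mem_groupG x)]
  · rw [← map_parity_symHom_of_one (x := symIndex0) rfl] at h3
    obtain ⟨x, _, rfl⟩ := exists_symHom_eq (isChain_symHom symIndex0 (h.isChain hv.1))
      (h.isChain hw.1) h3.symm
    rw [wordClass_apply (symHom_mem_groupG x), wordClass_apply (symHom_mem_groupG _)]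

theorem isMultigraphTree_removeLoops_of_vertexSet_eq_singleton {V E : Type*} {Γ : Graph V E}
    {x : V} (hx : Γ.vertexSet = {x}) : IsMultigraphTree (removeLoops Γ) := by
  have hlink : ∀ e y z, ¬ (removeLoops Γ).IsLink e y z := by
    intro e y z hl
    have h1 : Γ.IsLink e y z ∧ ¬ ∃ x, Γ.IsLoopAt e x := by
      simpa [removeLoops] using hl
    have hy : y = x := by simpa [hx] using h1.1.left_mem
    have hz : z = x := by simpa [hx] using h1.1.right_mem
    subst hy hz
    exact h1.2 ⟨_, h1.1⟩
  have hV : (removeLoops Γ).vertexSet = {x} := by simpa [removeLoops] using hx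
  refine ⟨{ not_isLoopAt := fun e y => hlink e y y
            eq_of_isLink := fun e _ y z hl => absurd hl (hlink e y z) }, ?_⟩
  have : Unique (removeLoops Γ).vertexSet := hV ▸ Set.uniqueSingleton x
  exact SimpleGraph.IsTree.of_subsingleton

theorem IsFixedPoint.isRich (h : IsFixedPoint phi u) :
    IsRich groupG isSymmetryGroup_groupG u := by
  intro n hn
  refine ⟨h.isClosedUnder, ?_, ?_⟩
  · rintro e x ⟨e', he', hE, -⟩
    obtain ⟨g, hg, rfl⟩ : e ∈ wordClass groupG e' := hE ▸ mem_wordClass_self groupG e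
    exact (h.isGPalindrome_of_isEdgeWord hn he').apply hg
  · have hs : IsSpecial u (factor u 0 n) :=
      (h.isSpecial_factor_parity_iff hn 0).2 (h.fib_parity.isSpecial_factor_iff.2 (Or.inl rfl))
    refine isMultigraphTree_removeLoops_of_vertexSet_eq_singleton
      (x := wordClass groupG (factor u 0 n)) ?_
    ext x
    constructor
    · rintro ⟨w, hw, hws, rfl⟩
      refine h.wordClass_eq_of_isSpecial hws hs (by simpa using hw) ?_
      exact List.ne_nil_of_length_pos (by omega)
    · rintro rfl
      exact ⟨_, length_factor u 0 n, hs, rfl⟩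

end Richness

end GRich

theorem mainTheorem7 :
    ∃ hG : GRich.IsSymmetryGroup GRich.groupG,
      Nonempty (GRich.groupG ≃* Multiplicative (ZMod 2 × ZMod 2 × ZMod 2)) ∧
      (∃! u : ℕ → Fin 8, GRich.IsFixedPoint GRich.phi u) ∧
      ∀ u : ℕ → Fin 8, GRich.IsFixedPoint GRich.phi u →
        GRich.IsClosedUnder GRich.groupG u ∧ GRich.IsRich GRich.groupG hG u :=
  ⟨GRich.isSymmetryGroup_groupG, GRich.nonempty_groupG_mulEquiv,
    GRich.existsUnique_isFixedPoint_phi, fun _ hu => ⟨hu.isClosedUnder, hu.isRich⟩⟩
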